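/- Let $L^\infty(S^1)$ be the complex Banach space of (essentially) bounded complex-valued functions on $S^1=\mathbb R/2\pi\mathbb Z$, and let $X$ be the complex vector space of all sequences $a=(a_1,a_2,\dots)$ in $L^\infty(S^1)$ for which there is $l>0$ with $\sup_{S^1}|a_i|\le l^i$ for all $i\ge 1$. Equip $X$ with any locally convex vector space topology for which all coordinate maps $a\mapsto a_i\in L^\infty(S^1)$ are continuous (for example the product topology). For $i_1,\dots,i_k\ge 1$ let $$I_{i_1,\dots,i_k}(a)=\int\cdots\int_{0\le s_1\le\cdots\le s_k\le 2\pi}a_{i_k}(s_k)\cdots a_{i_1}(s_1)\,ds_k\cdots ds_1$$ (equal to $1$ for $k=0$). An iterated polynomial of degree $d$ in $a_1,\dots,a_m$ is a complex linear combination of functions $I_{i_1,\dots,i_k}$ with $k\le d$ and $i_1,\dots,i_k\le m$. For $n\ge 1$ let $$c_n(a)=\sum_{i_1+\dots+i_k=n}c_{i_1,\dots,i_k}I_{i_1,\dots,i_k}(a),\qquad c_{i_1,\dots,i_k}=(n-i_1+1)(n-i_1-i_2+1)\cdots 1 ,$$ where the sum is over all $k\ge1$ and all $i_1,\dots,i_k\ge1$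 with sum $n$. Then for every $n\ge 1$: (a) $c_n(a)=I_n(a)+f_n(a)$ for all $a\in X$, where $I_n(a)=\int_0^{2\pi}a_n(s)\,ds$ and $f_n$ is an iterated polynomial of degree $n$ in $a_1,\dots,a_{n-1}$. (b) The set $\mathcal C_n=\{a\in X: c_1(a)=\dots=c_n(a)=0\}$ is a closed complex submanifold of $X$ of codimension $n$ containing $0$. That is, $\mathcal C_n$ is closed in $X$, $0\in\mathcal C_n$, and near each of its points there is a biholomorphic map between open subsets of $X$ that carries $\mathcal C_n$ to a closed linear subspace of codimension $n$. Here holomorphic means continuous and Gateaux holomorphic. (c) The tangent space to $\mathcal C_n$ at $0$, i.e. the set of velocities $\gamma'(0)$ of holomorphic discs $\gamma$ in $X$ lying in $\mathcal C_n$ with $\gamma(0)=0$, equals $\{a\in X: I_1(a)=\dots=I_n(a)=0\}$. -/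

import Mathlib

open Real MeasureTheory Filter Topology
open scoped ENNReal

namespace CenterProblem

/-- The positivity of the period, needed for the Lebesgue measure on the circle. -/
instance factTwoPiPos : Fact ((0 : ℝ) < 2 * π) := ⟨Real.two_pi_pos⟩

/-- The circle `S¹ = ℝ / 2πℤ`, with the Lebesgue measure of total mass `2π`. -/
abbrev Circ : Type := AddCircle (2 * π)

/-- The complex Banach space `L^∞(S¹)`; its norm is the essential supremum. -/
abbrev LInf : Type := Lp ℂ ∞ (volume : Measure Circ)

/-- The complex vector space of all sequences `a = (a₁, a₂, …)` in `L^∞(S¹)` for which there is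
an `l > 0` with `sup |a_i| ≤ l ^ i` for all `i ≥ 1`. -/
def coeffSubmodule : Submodule ℂ (ℕ+ → LInf) where
  carrier := {a | ∃ l : ℝ, 0 < l ∧ ∀ i : ℕ+, ‖a i‖ ≤ l ^ (i : ℕ)}
  zero_mem' := ⟨1, one_pos, fun i => by simp⟩
  add_mem' := by
    rintro a b ⟨l, hl, ha⟩ ⟨m, hm, hb⟩
    refine ⟨l + m, by positivity, fun i => ?_⟩
    calc ‖(a + b) i‖ ≤ ‖a i‖ + ‖b i‖ := norm_add_le _ _
      _ ≤ l ^ (i : ℕ) + m ^ (i : ℕ) := add_le_add (ha i) (hb i)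
      _ ≤ (l + m) ^ (i : ℕ) := pow_add_pow_le hl.le hm.le i.ne_zero
  smul_mem' := by
    rintro c a ⟨l, hl, ha⟩
    refine ⟨(‖c‖ + 1) * l, by positivity, fun i => ?_⟩
    have h1 : ‖c‖ ≤ (‖c‖ + 1) ^ (i : ℕ) :=
      (le_add_of_nonneg_right zero_le_one).trans
        (le_self_pow₀ (le_add_of_nonneg_left (norm_nonneg c)) i.ne_zero)
    calc ‖(c • a) i‖ = ‖c‖ * ‖a i‖ := norm_smul c (a i)
      _ ≤ (‖c‖ + 1) ^ (i : ℕ) * l ^ (i : ℕ) :=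
          mul_le_mul h1 (ha i) (norm_nonneg _) (by positivity)
      _ = ((‖c‖ + 1) * l) ^ (i : ℕ) := (mul_pow _ _ _).symm

/-- The space `X` of coefficient sequences. It is a type of its own, so that it carries no
topology yet. -/
def X : Type := coeffSubmodule

noncomputable instance : AddCommGroup X := inferInstanceAs (AddCommGroup coeffSubmodule)

noncomputable instance : Module ℂ X := inferInstanceAs (Module ℂ coeffSubmodule)

/-- The coordinate `a ↦ a_i`, from `X` to `L^∞(S¹)`. -/
def X.coord (a : X) (i : ℕ+) : LInf := a.1 i

/-- The domain `0 ≤ s₁ ≤ ⋯ ≤ s_k ≤ 2π` of the iterated integrals of order `k`. -/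
def simplex (k : ℕ) : Set (Fin k → ℝ) :=
  {s | Monotone s ∧ ∀ j, s j ∈ Set.Icc 0 (2 * π)}

/-- The basic iterated integral `I_{i₁, …, i_k}(a)`, the integral of
`a_{i_k}(s_k) ⋯ a_{i₁}(s₁)` over `0 ≤ s₁ ≤ ⋯ ≤ s_k ≤ 2π`; it equals `1` for `k = 0`. -/
noncomputable def iterInt {k : ℕ} (i : Fin k → ℕ+) (a : X) : ℂ :=
  ∫ s in simplex k, ∏ j, a.coord (i j) (s j : Circ)

/-- The linear functional `I_n(a) = ∫₀^{2π} a_n(s) ds`. -/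
noncomputable def linInt (n : ℕ+) (a : X) : ℂ :=
  ∫ s in (0 : ℝ)..(2 * π), a.coord n (s : Circ)

/-- The iterated polynomials of degree `d` in `a₁, …, a_m`: the linear combinations of basic
iterated integrals of order at most `d` with all indices at most `m`. -/
def iterPoly (d m : ℕ) : Submodule ℂ (X → ℂ) :=
  Submodule.span ℂ
    {f | ∃ (k : ℕ) (i : Fin k → ℕ+), k ≤ d ∧ (∀ j, (i j : ℕ) ≤ m) ∧ f = iterInt i}

/-- The indices `i₁, …, i_k ≥ 1` of a composition `i₁ + ⋯ + i_k = n`. -/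
def indices {n : ℕ} (p : Composition n) (j : Fin p.length) : ℕ+ :=
  ⟨p.blocksFun j, p.one_le_blocksFun j⟩

/-- The coefficient `c_{i₁, …, i_k} = (n - i₁ + 1) (n - i₁ - i₂ + 1) ⋯ 1` of a composition
`i₁ + ⋯ + i_k = n`. The subtraction does not truncate, since `i₁ + ⋯ + i_j ≤ n`. -/
def coeffC {n : ℕ} (p : Composition n) : ℕ :=
  ∏ j : Fin p.length, (n - p.sizeUpTo (j + 1) + 1)

/-- `c_n(a) = ∑_{i₁ + ⋯ + i_k = n} c_{i₁, …, i_k} I_{i₁, …, i_k}(a)`. -/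
noncomputable def c (n : ℕ+) (a : X) : ℂ :=
  ∑ p : Composition n, (coeffC p : ℂ) * iterInt (indices p) a

/-- `𝒞_n = {a ∈ X : c₁(a) = ⋯ = c_n(a) = 0}`. -/
def centerSet (n : ℕ+) : Set X := {a | ∀ k ≤ n, c k a = 0}

section Manifolds

variable {E F : Type*} [AddCommGroup E] [Module ℂ E] [TopologicalSpace E]
  [AddCommGroup F] [Module ℂ F] [TopologicalSpace F]

/-- A map between locally convex spaces is holomorphic on an open set `U` if it is continuous
there and Gateaux holomorphic: for every `x ∈ U`, every direction `h` and every continuous linear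
functional `ℓ`, the function `z ↦ ℓ (f (x + z h))` of one complex variable is holomorphic
near `0`. -/
def HolomorphicOn (f : E → F) (U : Set E) : Prop :=
  ContinuousOn f U ∧
    ∀ x ∈ U, ∀ h : E, ∀ ℓ : F →L[ℂ] ℂ, AnalyticAt ℂ (fun z : ℂ => ℓ (f (x + z • h))) 0

/-- `S` is a complex submanifold of codimension `n` of the locally convex space `E`: near each of
its points a biholomorphic map between open subsets of `E` carries `S` to a closed linear subspace
of codimension `n`. -/
def IsComplexSubmanifold (S : Set E) (n : ℕ) : Prop :=
  ∀ p ∈ S, ∃ (L : Submodule ℂ E) (φ : OpenPartialHomeomorph E E),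
    IsClosed (L : Set E) ∧ Module.rank ℂ (E ⧸ L) = n ∧
    p ∈ φ.source ∧ HolomorphicOn φ φ.source ∧ HolomorphicOn φ.symm φ.target ∧
    ∀ x ∈ φ.source, x ∈ S ↔ φ x ∈ L

/-- The tangent space to `S` at `p`, as a subset of `E`: the velocities `γ'(0)` of the holomorphic
discs `γ` in `E` that lie in `S` and satisfy `γ(0) = p`. -/
def tangentVectors (S : Set E) (p : E) : Set E :=
  {h | ∃ (γ : ℂ → E) (ε : ℝ), 0 < ε ∧ HolomorphicOn γ (Metric.ball 0 ε) ∧ γ 0 = p ∧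
    (∀ z ∈ Metric.ball (0 : ℂ) ε, γ z ∈ S) ∧
    Tendsto (fun z : ℂ => z⁻¹ • (γ z - p)) (𝓝[≠] 0) (𝓝 h)}

end Manifolds

end CenterProblem

namespace CenterProblem

/-! In `c n = linInt n + higherPart n` the last term, f_n, collects the compositions with at least
two parts, so it reads only the coordinates below n. Let e_n = `unitSeq n`, so that I_k(e_n) = δ_kn.
The shear a ↦ a + f_n(a) e_n changes only coordinate n, which f_n does not see; its inverse is a ↦ a
- f_n(a) e_n, and it turns c_n into I_n (`linInt_shear_self`).

Composing the shears for n, …, 1 gives one global chart carrying `centerSet n` to `linKer n`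
(`linInt_chart`). Iterated integrals are continuous multilinear forms in the coordinates
(`simplexFormL`), so continuity of the coordinates is enough to make the chart and its inverse
holomorphic.

Every term of f_n is homogeneous of degree at least 2, so shears preserve velocities at 0
(`tendsto_inv_smul_shear`); this gives the tangent space. -/

/-! ### Iterated integrals as continuous multilinear forms -/

lemma quasiMeasurePreserving_coe :
    Measure.QuasiMeasurePreserving (fun x : ℝ => (x : Circ))
      (volume.restrict (Set.Icc 0 (2 * π))) volume := by
  have h := (AddCircle.measurePreserving_mk (2 * π) 0).quasiMeasurePreserving
  rw [zero_add, restrict_Ioc_eq_restrict_Icc] at h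
  exact h

lemma restrict_simplex_le (k : ℕ) :
    (volume : Measure (Fin k → ℝ)).restrict (simplex k) ≤
      Measure.pi fun _ => (volume : Measure ℝ).restrict (Set.Icc 0 (2 * π)) := by
  rw [← Measure.restrict_pi_pi]
  exact Measure.restrict_mono (fun s hs j _ => hs.2 j) le_rfl

instance isFiniteMeasure_restrict_simplex (k : ℕ) :
    IsFiniteMeasure ((volume : Measure (Fin k → ℝ)).restrict (simplex k)) :=
  isFiniteMeasure_of_le _ (restrict_simplex_le k)

/-- Elements of `LInf` are classes modulo null sets; this pulls almost-everywhere statements on the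
circle back to the simplex. -/
lemma quasiMeasurePreserving_simplex {k : ℕ} (j : Fin k) :
    Measure.QuasiMeasurePreserving (fun s : Fin k → ℝ => (s j : Circ))
      (volume.restrict (simplex k)) volume :=
  (quasiMeasurePreserving_coe.comp (Measure.quasiMeasurePreserving_eval _ j)).mono_left
    (restrict_simplex_le k).absolutelyContinuous

lemma aestronglyMeasurable_prod {k : ℕ} (b : Fin k → LInf) :
    AEStronglyMeasurable (fun s : Fin k → ℝ => ∏ j, b j (s j : Circ))
      (volume.restrict (simplex k)) :=
  Finset.aestronglyMeasurable_fun_prod _ fun j _ =>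
    (Lp.aestronglyMeasurable (b j)).comp_quasiMeasurePreserving (quasiMeasurePreserving_simplex j)

lemma ae_norm_le (b : LInf) : ∀ᵐ x : Circ, ‖b x‖ ≤ ‖b‖ := by
  filter_upwards [enorm_ae_le_eLpNormEssSup b volume] with x hx
  rw [Lp.norm_def, eLpNorm_exponent_top, ← toReal_enorm]
  refine ENNReal.toReal_mono ?_ hx
  rw [← eLpNorm_exponent_top]
  exact Lp.eLpNorm_ne_top b

lemma ae_norm_prod_le {k : ℕ} (b : Fin k → LInf) :
    ∀ᵐ s : Fin k → ℝ ∂volume.restrict (simplex k),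
      ‖∏ j, b j (s j : Circ)‖ ≤ ∏ j, ‖b j‖ := by
  have h : ∀ j, ∀ᵐ s : Fin k → ℝ ∂volume.restrict (simplex k), ‖b j (s j : Circ)‖ ≤ ‖b j‖ :=
    fun j => (quasiMeasurePreserving_simplex j).ae (ae_norm_le (b j))
  filter_upwards [ae_all_iff.2 h] with s hs
  rw [norm_prod]
  exact Finset.prod_le_prod (fun _ _ => norm_nonneg _) fun j _ => hs j

lemma integrable_prod {k : ℕ} (b : Fin k → LInf) :
    Integrable (fun s : Fin k → ℝ => ∏ j, b j (s j : Circ)) (volume.restrict (simplex k)) :=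
  Integrable.of_bound (aestronglyMeasurable_prod b) _ (ae_norm_prod_le b)

/-- The iterated integral of order `k`, as a multilinear form on `L^∞(S¹)`. -/
noncomputable def simplexForm (k : ℕ) : MultilinearMap ℂ (fun _ : Fin k => LInf) ℂ where
  toFun b := ∫ s in simplex k, ∏ j, b j (s j : Circ)
  map_update_add' := by
    intro hd b i x y
    rw [← integral_add (integrable_prod _) (integrable_prod _)]
    refine integral_congr_ae ?_
    filter_upwards [(quasiMeasurePreserving_simplex i).ae (Lp.coeFn_add x y)] with s hs
    simp only [← Finset.mul_prod_erase _ _ (Finset.mem_univ i), Function.update_self]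
    have h : ∀ z : LInf, ∏ j ∈ Finset.univ.erase i, (Function.update b i z j) (s j : Circ) =
        ∏ j ∈ Finset.univ.erase i, b j (s j : Circ) := fun z =>
      Finset.prod_congr rfl fun j hj => by rw [Function.update_of_ne (Finset.ne_of_mem_erase hj)]
    rw [h, h, h, hs, Pi.add_apply, add_mul]
  map_update_smul' := by
    intro hd b i t x
    rw [← integral_smul]
    refine integral_congr_ae ?_
    filter_upwards [(quasiMeasurePreserving_simplex i).ae (Lp.coeFn_smul t x)] with s hs
    simp only [← Finset.mul_prod_erase _ _ (Finset.mem_univ i), Function.update_self]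
    have h : ∀ z : LInf, ∏ j ∈ Finset.univ.erase i, (Function.update b i z j) (s j : Circ) =
        ∏ j ∈ Finset.univ.erase i, b j (s j : Circ) := fun z =>
      Finset.prod_congr rfl fun j hj => by rw [Function.update_of_ne (Finset.ne_of_mem_erase hj)]
    rw [h, h, hs, Pi.smul_apply, smul_eq_mul, smul_eq_mul, mul_assoc]

/-- The iterated integral of order `k`, as a continuous multilinear form on `L^∞(S¹)`. -/
noncomputable def simplexFormL (k : ℕ) : ContinuousMultilinearMap ℂ (fun _ : Fin k => LInf) ℂ :=
  (simplexForm k).mkContinuous ((volume : Measure (Fin k → ℝ)).real (simplex k)) fun b => by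
    have h := norm_integral_le_of_norm_le_const (ae_norm_prod_le b)
    rw [measureReal_restrict_apply_univ] at h
    exact h.trans_eq (mul_comm _ _)

lemma iterInt_eq {k : ℕ} (i : Fin k → ℕ+) (a : X) :
    iterInt i a = simplexFormL k fun j => a.coord (i j) := rfl

lemma iterInt_congr {k : ℕ} {i : Fin k → ℕ+} {a b : X}
    (h : ∀ j, a.coord (i j) = b.coord (i j)) : iterInt i a = iterInt i b := by
  simp only [iterInt_eq, h]

@[simp] lemma coord_add (a b : X) (i : ℕ+) : (a + b).coord i = a.coord i + b.coord i := rfl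

@[simp] lemma coord_smul (t : ℂ) (a : X) (i : ℕ+) : (t • a).coord i = t • a.coord i := rfl

@[simp] lemma coord_zero (i : ℕ+) : (0 : X).coord i = 0 := rfl

lemma iterInt_smul {k : ℕ} (i : Fin k → ℕ+) (t : ℂ) (a : X) :
    iterInt i (t • a) = t ^ k * iterInt i a := by
  simp only [iterInt_eq, coord_smul]
  rw [(simplexFormL k).map_smul_univ (fun _ => t)]
  simp

lemma continuous_iterInt [TopologicalSpace X]
    (hX : ∀ i : ℕ+, Continuous fun a : X => a.coord i) {k : ℕ} (i : Fin k → ℕ+) :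
    Continuous (iterInt i) :=
  (simplexFormL k).cont.comp (continuous_pi fun j => hX (i j))

/-- Analyticity is asked of the coordinates, which live in a Banach space, since `X` has no norm. -/
lemma analyticAt_iterInt {k : ℕ} (i : Fin k → ℕ+) {γ : ℂ → X}
    (hγ : ∀ i, AnalyticAt ℂ (fun z => (γ z).coord i) 0) :
    AnalyticAt ℂ (fun z => iterInt i (γ z)) 0 :=
  (simplexFormL k).analyticAt.comp (AnalyticAt.pi fun j => hγ (i j))

lemma iterInt_one (n : ℕ+) (a : X) : iterInt (fun _ : Fin 1 => n) a = linInt n a := by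
  have e := volume_preserving_funUnique (Fin 1) ℝ
  have hs : simplex 1 = MeasurableEquiv.funUnique (Fin 1) ℝ ⁻¹' Set.Icc 0 (2 * π) := by
    ext s
    simp [simplex, Subsingleton.monotone]
  rw [iterInt, linInt, intervalIntegral.integral_of_le Real.two_pi_pos.le,
    ← integral_Icc_eq_integral_Ioc, hs,
    ← e.setIntegral_preimage_emb (MeasurableEquiv.measurableEmbedding _)]
  simp only [Finset.univ_unique, Finset.prod_singleton]
  rfl

lemma iterInt_of_length_eq_one {k : ℕ} (hk : k = 1) (i : Fin k → ℕ+) {n : ℕ+}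
    (hi : ∀ j, i j = n) (a : X) : iterInt i a = linInt n a := by
  subst hk
  rw [← iterInt_one, funext hi]

/-! ### The functionals I_n and a dual family -/

/-- The linear functional `I_n`, as a linear map. -/
noncomputable def linIntₗ (n : ℕ+) : X →ₗ[ℂ] ℂ where
  toFun := linInt n
  map_add' a b := by
    simp only [← iterInt_one, iterInt_eq, coord_add]
    -- With a single slot, multilinearity is linearity.
    have hu : ∀ x y : LInf, Function.update (fun _ : Fin 1 => x) 0 y = fun _ => y := fun x y => by
      funext j
      rw [Subsingleton.elim j 0, Function.update_self]
    have h := (simplexFormL 1).map_update_add (fun _ => a.coord n) 0 (a.coord n) (b.coord n)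
    rwa [hu, hu, hu] at h
  map_smul' t a := by
    simp only [← iterInt_one, iterInt_smul, pow_one, smul_eq_mul, RingHom.id_apply]

lemma linInt_congr {n : ℕ+} {a b : X} (h : a.coord n = b.coord n) : linInt n a = linInt n b := by
  simp only [linInt, h]

/-- The constant function `1 / 2π`, as an element of `L^∞(S¹)`. -/
noncomputable def constLInf : LInf := Lp.const ∞ volume ((2 * π : ℂ)⁻¹)

/-- The sequence whose `n`-th coordinate is the constant `1 / 2π`, the others being zero. -/
noncomputable def unitSeq (n : ℕ+) : X :=
  ⟨Pi.single n constLInf, ‖constLInf‖ + 1, by positivity, fun i => by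
    have h : ‖(Pi.single n constLInf : ℕ+ → LInf) i‖ ≤ ‖constLInf‖ + 1 := by
      by_cases hi : i = n
      · subst hi; simp
      · rw [Pi.single_eq_of_ne hi, norm_zero]; positivity
    exact h.trans (le_self_pow₀ (le_add_of_nonneg_left (norm_nonneg _)) i.ne_zero)⟩

lemma coord_unitSeq_self (n : ℕ+) : (unitSeq n).coord n = constLInf :=
  Pi.single_eq_same (M := fun _ => LInf) n constLInf

lemma coord_unitSeq_of_ne {n i : ℕ+} (h : i ≠ n) : (unitSeq n).coord i = 0 :=
  Pi.single_eq_of_ne (M := fun _ => LInf) h constLInf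

lemma linInt_unitSeq_self (n : ℕ+) : linInt n (unitSeq n) = 1 := by
  rw [linInt, coord_unitSeq_self, intervalIntegral.integral_of_le Real.two_pi_pos.le]
  have h : (fun s : ℝ => constLInf (s : Circ)) =ᵐ[volume.restrict (Set.Ioc 0 (2 * π))]
      fun _ => (2 * π : ℂ)⁻¹ := by
    rw [restrict_Ioc_eq_restrict_Icc]
    exact quasiMeasurePreserving_coe.ae (Lp.coeFn_const _ _ _)
  rw [integral_congr_ae h]
  have hπ : (π : ℂ) ≠ 0 := Complex.ofReal_ne_zero.2 Real.pi_ne_zero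
  simp [Real.two_pi_pos.le]
  field_simp

lemma linInt_unitSeq_of_ne {n k : ℕ+} (h : k ≠ n) : linInt k (unitSeq n) = 0 := by
  rw [linInt_congr (b := 0) (by rw [coord_unitSeq_of_ne h, coord_zero])]
  exact map_zero (linIntₗ k)

/-! ### Splitting off the linear term of c_n -/

/-- The sum of the terms of order at least two in `c_n`. -/
noncomputable def higherPart (n : ℕ+) : X → ℂ :=
  ∑ p ∈ Finset.univ.erase (Composition.single (n : ℕ) n.pos),
    (coeffC p : ℂ) • iterInt (indices p)

lemma higherPart_apply (n : ℕ+) (a : X) :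
    higherPart n a = ∑ p ∈ Finset.univ.erase (Composition.single (n : ℕ) n.pos),
      (coeffC p : ℂ) * iterInt (indices p) a := by
  simp [higherPart]

lemma coeffC_single (n : ℕ+) : coeffC (Composition.single (n : ℕ) n.pos) = 1 := by
  refine Finset.prod_eq_one fun j _ => ?_
  have hj : (j : ℕ) = 0 := by
    have := j.2
    have h := Composition.single_length n.pos
    omega
  -- The only factor is n - n + 1.
  rw [Composition.sizeUpTo_ofLength_le _ _ (by rw [hj, zero_add, Composition.single_length]),
    Nat.sub_self, zero_add]

lemma c_eq (n : ℕ+) (a : X) : c n a = linInt n a + higherPart n a := by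
  rw [higherPart_apply, c, ← Finset.add_sum_erase _ _ (Finset.mem_univ
    (Composition.single (n : ℕ) n.pos)), coeffC_single, Nat.cast_one, one_mul,
    iterInt_of_length_eq_one (Composition.single_length n.pos) (n := n)]
  exact fun j => Subtype.ext (Composition.single_blocksFun n.pos j)

lemma indices_lt {n : ℕ+} {p : Composition n}
    (hp : p ∈ Finset.univ.erase (Composition.single (n : ℕ) n.pos)) (j : Fin p.length) :
    indices p j < n :=
  (Composition.ne_single_iff n.pos).1 (Finset.ne_of_mem_erase hp) j

lemma two_le_length {n : ℕ+} {p : Composition n}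
    (hp : p ∈ Finset.univ.erase (Composition.single (n : ℕ) n.pos)) : 2 ≤ p.length := by
  have h1 : p.length ≠ 1 := fun h =>
    Finset.ne_of_mem_erase hp ((Composition.eq_single_iff_length n.pos).2 h)
  have h0 := p.length_pos_of_pos n.pos
  omega

lemma higherPart_mem_iterPoly (n : ℕ+) : higherPart n ∈ iterPoly n (n - 1) := by
  refine Submodule.sum_mem _ fun p hp => Submodule.smul_mem _ _ (Submodule.subset_span ?_)
  exact ⟨p.length, indices p, p.length_le, fun j => Nat.le_sub_one_of_lt (indices_lt hp j), rfl⟩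

lemma higherPart_congr {n : ℕ+} {a b : X} (h : ∀ i < n, a.coord i = b.coord i) :
    higherPart n a = higherPart n b := by
  simp only [higherPart_apply]
  exact Finset.sum_congr rfl fun p hp => by
    rw [iterInt_congr fun j => h _ (indices_lt hp j)]

lemma c_congr {n : ℕ+} {a b : X} (h : ∀ i ≤ n, a.coord i = b.coord i) : c n a = c n b := by
  rw [c_eq, c_eq, linInt_congr (h n le_rfl), higherPart_congr fun i hi => h i hi.le]

lemma higherPart_zero (n : ℕ+) : higherPart n 0 = 0 := by
  rw [higherPart_apply]
  refine Finset.sum_eq_zero fun p hp => ?_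
  have h := iterInt_smul (indices p) 0 0
  rw [zero_smul, zero_pow (p.length_pos_of_pos n.pos).ne', zero_mul] at h
  rw [h, mul_zero]

lemma analyticAt_higherPart (n : ℕ+) {γ : ℂ → X}
    (hγ : ∀ i, AnalyticAt ℂ (fun z => (γ z).coord i) 0) :
    AnalyticAt ℂ (fun z => higherPart n (γ z)) 0 := by
  simp only [higherPart_apply]
  exact Finset.analyticAt_fun_sum _ fun p _ =>
    analyticAt_const.mul (analyticAt_iterInt (indices p) hγ)

/-! ### Shears and the linear model -/

/-- The shear `a ↦ a + t f_n(a) e_n`, where `f_n` is the higher part of `c_n`. -/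
noncomputable def shear (n : ℕ+) (t : ℂ) (a : X) : X := a + (t * higherPart n a) • unitSeq n

lemma coord_shear_of_ne {n i : ℕ+} (h : i ≠ n) (t : ℂ) (a : X) :
    (shear n t a).coord i = a.coord i := by
  rw [shear, coord_add, coord_smul, coord_unitSeq_of_ne h, smul_zero, add_zero]

lemma higherPart_shear (n : ℕ+) (t : ℂ) (a : X) : higherPart n (shear n t a) = higherPart n a :=
  higherPart_congr fun _ hi => coord_shear_of_ne hi.ne t a

lemma shear_zero (n : ℕ+) (t : ℂ) : shear n t 0 = 0 := by
  rw [shear, higherPart_zero, mul_zero, zero_smul, add_zero]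

lemma shear_neg_shear (n : ℕ+) (t : ℂ) (a : X) : shear n (-t) (shear n t a) = a := by
  rw [shear, higherPart_shear, shear, add_assoc, ← add_smul]
  simp

lemma linInt_shear_self (n : ℕ+) (a : X) : linInt n (shear n 1 a) = c n a := by
  change linIntₗ n (a + (1 * higherPart n a) • unitSeq n) = _
  rw [map_add, map_smul, c_eq, smul_eq_mul, one_mul]
  change _ + _ * linInt n (unitSeq n) = _
  rw [linInt_unitSeq_self, mul_one]
  rfl

lemma zero_mem_centerSet (n : ℕ+) : (0 : X) ∈ centerSet n := fun k _ => by
  rw [c_eq, higherPart_zero, add_zero]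
  exact map_zero (linIntₗ k)

/-- The joint kernel of `I_1, …, I_n`. -/
noncomputable def linKer (n : ℕ+) : Submodule ℂ X :=
  -- The index k of `Fin n` stands for k + 1.
  LinearMap.ker (LinearMap.pi fun k : Fin n => linIntₗ k.1.succPNat)

lemma mem_linKer {n : ℕ+} {a : X} : a ∈ linKer n ↔ ∀ k ≤ n, linInt k a = 0 := by
  rw [linKer, LinearMap.mem_ker, funext_iff]
  constructor
  · intro h k hk
    have hk' : (k : ℕ) ≤ n := hk
    have h1 : k.natPred.succPNat = k := PNat.succPNat_natPred k
    have h2 := h ⟨k.natPred, by rw [PNat.natPred]; have := k.pos; omega⟩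
    change linInt k.natPred.succPNat a = 0 at h2
    rwa [h1] at h2
  · exact fun h k => h _ (Nat.succ_le_of_lt k.2)

lemma rank_quotient_linKer (n : ℕ+) : Module.rank ℂ (X ⧸ linKer n) = (n : ℕ) := by
  have hs : Function.Surjective (LinearMap.pi fun k : Fin n => linIntₗ k.1.succPNat) := by
    intro v
    refine ⟨∑ j, v j • unitSeq (j : ℕ).succPNat, funext fun k => ?_⟩
    rw [map_sum, Finset.sum_apply, Finset.sum_eq_single k]
    · rw [map_smul, Pi.smul_apply, LinearMap.pi_apply]
      change v k • linInt _ _ = _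
      rw [linInt_unitSeq_self, smul_eq_mul, mul_one]
    · intro j _ hj
      rw [map_smul, Pi.smul_apply, LinearMap.pi_apply]
      change v j • linInt _ _ = _
      rw [linInt_unitSeq_of_ne, smul_zero]
      exact fun h => hj (Fin.ext (Nat.succPNat_injective h.symm))
    · exact fun h => absurd (Finset.mem_univ k) h
  rw [linKer, (LinearMap.quotKerEquivOfSurjective _ hs).rank_eq, rank_fin_fun]

/-! ### Continuity, weak analyticity and velocities -/

section Topology

variable [TopologicalSpace X]

lemma continuous_linInt (hX : ∀ i : ℕ+, Continuous fun a : X => a.coord i) (n : ℕ+) :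
    Continuous (linInt n) := by
  have h := continuous_iterInt hX fun _ : Fin 1 => n
  rwa [funext (iterInt_one n)] at h

lemma continuous_higherPart (hX : ∀ i : ℕ+, Continuous fun a : X => a.coord i) (n : ℕ+) :
    Continuous (higherPart n) := by
  rw [higherPart, Finset.sum_fn]
  exact continuous_finsetSum _ fun p _ => (continuous_iterInt hX (indices p)).const_smul _

lemma continuous_c (hX : ∀ i : ℕ+, Continuous fun a : X => a.coord i) (n : ℕ+) :
    Continuous (c n) := by
  rw [funext (c_eq n)]
  exact (continuous_linInt hX n).add (continuous_higherPart hX n)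

lemma isClosed_linKer (hX : ∀ i : ℕ+, Continuous fun a : X => a.coord i) (n : ℕ+) :
    IsClosed (linKer n : Set X) := by
  have h : (linKer n : Set X) = {a | ∀ k ≤ n, linInt k a = 0} := Set.ext fun _ => mem_linKer
  simp only [h, Set.ofPred_forall]
  exact isClosed_iInter fun k => isClosed_iInter fun _ =>
    isClosed_eq (continuous_linInt hX k) continuous_const

lemma isClosed_centerSet (hX : ∀ i : ℕ+, Continuous fun a : X => a.coord i) (n : ℕ+) :
    IsClosed (centerSet n) := by
  simp only [centerSet, Set.ofPred_forall]
  exact isClosed_iInter fun k => isClosed_iInter fun _ =>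
    isClosed_eq (continuous_c hX k) continuous_const

/-- A curve is weakly analytic at `0` if its coordinates and its compositions with the continuous
linear functionals are analytic there. -/
def WeaklyAnalytic (γ : ℂ → X) : Prop :=
  (∀ i, AnalyticAt ℂ (fun z => (γ z).coord i) 0) ∧
    ∀ ℓ : X →L[ℂ] ℂ, AnalyticAt ℂ (fun z => ℓ (γ z)) 0

lemma weaklyAnalytic_line (x h : X) : WeaklyAnalytic fun z : ℂ => x + z • h := by
  refine ⟨fun i => ?_, fun ℓ => ?_⟩
  · simp only [coord_add, coord_smul]
    exact analyticAt_const.add (analyticAt_id.smul analyticAt_const)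
  · simp only [map_add, map_smul]
    exact analyticAt_const.add (analyticAt_id.smul analyticAt_const)

/-- The coordinate condition makes f_n(γ z) analytic, and the shear adds this scalar times a fixed
vector. The functional condition is the one `HolomorphicOn` requires. -/
lemma WeaklyAnalytic.shear {γ : ℂ → X} (hγ : WeaklyAnalytic γ) (n : ℕ+) (t : ℂ) :
    WeaklyAnalytic fun z => shear n t (γ z) := by
  have h := (analyticAt_const (v := t)).mul (analyticAt_higherPart n hγ.1)
  refine ⟨fun i => ?_, fun ℓ => ?_⟩
  · simp only [CenterProblem.shear, coord_add, coord_smul]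
    exact (hγ.1 i).add (h.smul analyticAt_const)
  · simp only [CenterProblem.shear, map_add, map_smul]
    exact (hγ.2 ℓ).add (h.smul analyticAt_const)

/-- Along a curve with a velocity at `0`, the higher part of `c_n` vanishes to second order. -/
lemma tendsto_inv_mul_higherPart (hX : ∀ i : ℕ+, Continuous fun a : X => a.coord i) (n : ℕ+)
    {γ : ℂ → X} {h : X} (hγ : Tendsto (fun z : ℂ => z⁻¹ • γ z) (𝓝[≠] 0) (𝓝 h)) :
    Tendsto (fun z : ℂ => z⁻¹ * higherPart n (γ z)) (𝓝[≠] 0) (𝓝 0) := by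
  simp only [higherPart_apply, Finset.mul_sum]
  suffices h0 : ∀ p ∈ Finset.univ.erase (Composition.single (n : ℕ) n.pos),
      Tendsto (fun z : ℂ => z⁻¹ * (coeffC p * iterInt (indices p) (γ z))) (𝓝[≠] 0) (𝓝 0) by
    simpa using tendsto_finsetSum _ h0
  intro p hp
  -- For a term I of order k ≥ 2, homogeneity gives z⁻¹ I(γ z) = z ^ (k - 1) I(z⁻¹ γ z), where the
  -- last factor converges to I(h).
  have hz : Tendsto (fun z : ℂ => z ^ (p.length - 1)) (𝓝[≠] 0) (𝓝 0) := by
    have h2 : p.length - 1 ≠ 0 := by have := two_le_length hp; omega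
    have := (continuous_pow (M := ℂ) (p.length - 1)).tendsto 0
    rw [zero_pow h2] at this
    exact this.mono_left nhdsWithin_le_nhds
  have hi := ((continuous_iterInt hX (indices p)).tendsto h).comp hγ
  have hm := (hz.mul hi).const_mul (coeffC p : ℂ)
  rw [zero_mul, mul_zero] at hm
  refine hm.congr' ?_
  filter_upwards [self_mem_nhdsWithin] with z hz0
  have hz0 : z ≠ 0 := hz0
  have hs : iterInt (indices p) (γ z) = z ^ p.length * iterInt (indices p) (z⁻¹ • γ z) := by
    rw [← iterInt_smul, smul_inv_smul₀ hz0]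
  have hp1 : z ^ p.length = z * z ^ (p.length - 1) := by
    rw [← pow_succ', Nat.sub_add_cancel (one_le_two.trans (two_le_length hp))]
  rw [hs, hp1, Function.comp_apply]
  field_simp

/-! ### The global chart -/

variable [IsTopologicalAddGroup X] [ContinuousSMul ℂ X]

lemma continuous_shear (hX : ∀ i : ℕ+, Continuous fun a : X => a.coord i) (n : ℕ+) (t : ℂ) :
    Continuous (shear n t) :=
  continuous_id.add ((continuous_const.mul (continuous_higherPart hX n)).smul continuous_const)

lemma tendsto_inv_smul_shear (hX : ∀ i : ℕ+, Continuous fun a : X => a.coord i) (n : ℕ+) (t : ℂ)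
    {γ : ℂ → X} {h : X} (hγ : Tendsto (fun z : ℂ => z⁻¹ • γ z) (𝓝[≠] 0) (𝓝 h)) :
    Tendsto (fun z : ℂ => z⁻¹ • shear n t (γ z)) (𝓝[≠] 0) (𝓝 h) := by
  have h1 := hγ.add ((((tendsto_inv_mul_higherPart hX n hγ).const_mul t)).smul_const (unitSeq n))
  rw [mul_zero, zero_smul, add_zero] at h1
  refine h1.congr fun z => ?_
  rw [shear, smul_add, smul_smul, mul_left_comm]

/-- The shear `a ↦ a + f_n(a) e_n`, as a homeomorphism. -/
noncomputable def shearHomeo (hX : ∀ i : ℕ+, Continuous fun a : X => a.coord i) (n : ℕ+) :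
    X ≃ₜ X where
  toFun := shear n 1
  invFun := shear n (-1)
  left_inv := shear_neg_shear n 1
  right_inv a := by simpa using shear_neg_shear n (-1) a
  continuous_toFun := continuous_shear hX n 1
  continuous_invFun := continuous_shear hX n (-1)

/-- The global chart `a ↦ a + ∑_{k ≤ n} f_k(a) e_k`, as a composition of shears. -/
noncomputable def chart (hX : ∀ i : ℕ+, Continuous fun a : X => a.coord i) : ℕ → (X ≃ₜ X)
  | 0 => Homeomorph.refl X
  | n + 1 => (shearHomeo hX n.succPNat).trans (chart hX n)

lemma chart_succ (hX : ∀ i : ℕ+, Continuous fun a : X => a.coord i) (n : ℕ) (a : X) :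
    chart hX (n + 1) a = chart hX n (shear n.succPNat 1 a) := rfl

lemma chart_succ_symm (hX : ∀ i : ℕ+, Continuous fun a : X => a.coord i) (n : ℕ) (a : X) :
    (chart hX (n + 1)).symm a = shear n.succPNat (-1) ((chart hX n).symm a) := rfl

lemma coord_chart (hX : ∀ i : ℕ+, Continuous fun a : X => a.coord i) (n : ℕ) (a : X) {i : ℕ+}
    (hi : n < (i : ℕ)) : (chart hX n a).coord i = a.coord i := by
  induction n generalizing a with
  | zero => rfl
  | succ n ih =>
    rw [chart_succ, ih _ (by omega), coord_shear_of_ne]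
    rintro rfl
    exact absurd hi (by simp)

lemma linInt_chart (hX : ∀ i : ℕ+, Continuous fun a : X => a.coord i) (n : ℕ) (a : X) {k : ℕ+}
    (hk : (k : ℕ) ≤ n) : linInt k (chart hX n a) = c k a := by
  induction n generalizing a with
  | zero => exact absurd k.pos (by omega)
  | succ n ih =>
    rw [chart_succ]
    rcases Nat.lt_or_ge n k with h | h
    -- The shear of index n + 1 acts first and turns c_{n+1} into I_{n+1}; the later ones leave
    -- coordinate n + 1 alone.
    · obtain rfl : k = n.succPNat := PNat.eq (by rw [Nat.succPNat_coe]; omega)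
      rw [linInt_congr (coord_chart hX n _ h), linInt_shear_self]
    -- Here c_k reads only coordinates up to k ≤ n, which this shear fixes.
    · rw [ih _ h]
      refine c_congr fun i hi => coord_shear_of_ne ?_ _ _
      rintro rfl
      have : (n.succPNat : ℕ) ≤ k := hi
      rw [Nat.succPNat_coe] at this
      omega

lemma WeaklyAnalytic.chart {γ : ℂ → X} (hγ : WeaklyAnalytic γ)
    (hX : ∀ i : ℕ+, Continuous fun a : X => a.coord i) (n : ℕ) :
    WeaklyAnalytic fun z => chart hX n (γ z) := by
  induction n generalizing γ with
  | zero => exact hγ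
  | succ n ih => exact ih (hγ.shear n.succPNat 1)

lemma WeaklyAnalytic.chart_symm {γ : ℂ → X} (hγ : WeaklyAnalytic γ)
    (hX : ∀ i : ℕ+, Continuous fun a : X => a.coord i) (n : ℕ) :
    WeaklyAnalytic fun z => (CenterProblem.chart hX n).symm (γ z) := by
  induction n with
  | zero => exact hγ
  | succ n ih => exact ih.shear n.succPNat (-1)

lemma tendsto_inv_smul_chart_symm (hX : ∀ i : ℕ+, Continuous fun a : X => a.coord i) (n : ℕ)
    {γ : ℂ → X} {h : X} (hγ : Tendsto (fun z : ℂ => z⁻¹ • γ z) (𝓝[≠] 0) (𝓝 h)) :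
    Tendsto (fun z : ℂ => z⁻¹ • (chart hX n).symm (γ z)) (𝓝[≠] 0) (𝓝 h) := by
  induction n with
  | zero => exact hγ
  | succ n ih => exact tendsto_inv_smul_shear hX n.succPNat (-1) ih

lemma chart_symm_zero (hX : ∀ i : ℕ+, Continuous fun a : X => a.coord i) (n : ℕ) :
    (chart hX n).symm 0 = 0 := by
  induction n with
  | zero => rfl
  | succ n ih => rw [chart_succ_symm, ih, shear_zero]

lemma mem_centerSet_iff_chart (hX : ∀ i : ℕ+, Continuous fun a : X => a.coord i) {n : ℕ+}
    {a : X} : a ∈ centerSet n ↔ chart hX n a ∈ linKer n := by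
  rw [mem_linKer]
  exact forall₂_congr fun k hk => by rw [linInt_chart hX n a hk]

/-! ### Submanifold structure and tangent space -/

lemma isComplexSubmanifold_centerSet (hX : ∀ i : ℕ+, Continuous fun a : X => a.coord i)
    (n : ℕ+) : IsComplexSubmanifold (centerSet n) n := fun p _ =>
  ⟨linKer n, (chart hX n).toOpenPartialHomeomorph, isClosed_linKer hX n, rank_quotient_linKer n,
    Set.mem_univ p,
    ⟨(chart hX n).continuous.continuousOn, fun x _ h ℓ =>
      ((weaklyAnalytic_line x h).chart hX n).2 ℓ⟩,
    ⟨(chart hX n).symm.continuous.continuousOn, fun x _ h ℓ =>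
      ((weaklyAnalytic_line x h).chart_symm hX n).2 ℓ⟩,
    fun _ _ => mem_centerSet_iff_chart hX⟩

lemma tangentVectors_centerSet (hX : ∀ i : ℕ+, Continuous fun a : X => a.coord i) (n : ℕ+) :
    tangentVectors (centerSet n) 0 = {a : X | ∀ k ≤ n, linInt k a = 0} := by
  ext h
  constructor
  · rintro ⟨γ, ε, hε, -, -, hmem, hlim⟩ k hk
    simp only [sub_zero] at hlim
    -- This sum is z⁻¹ c_k(γ z), which vanishes near 0 because γ stays in the set; its limit is
    -- I_k(h).
    have h1 := (((continuous_linInt hX k).tendsto h).comp hlim).add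
      (tendsto_inv_mul_higherPart hX k hlim)
    rw [add_zero] at h1
    refine tendsto_nhds_unique h1 (tendsto_const_nhds.congr' ?_)
    filter_upwards [nhdsWithin_le_nhds (Metric.ball_mem_nhds (0 : ℂ) hε)] with z hz
    have hl : linInt k (z⁻¹ • γ z) = z⁻¹ * linInt k (γ z) := (linIntₗ k).map_smul _ _
    rw [Function.comp_apply, hl, ← mul_add, ← c_eq, hmem z hz k hk, mul_zero]
  · intro hh
    have hline : ∀ x d : ℂ, WeaklyAnalytic fun z : ℂ => (x + z • d) • h := fun x d => by
      simpa only [add_smul, smul_assoc] using weaklyAnalytic_line (x • h) (d • h)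
    -- The disc is the chart preimage of the complex line through h, which lies in `linKer n`; any
    -- radius would do.
    refine ⟨fun z => (chart hX n).symm (z • h), 1, one_pos, ⟨?_, ?_⟩, ?_, ?_, ?_⟩
    · exact ((chart hX n).symm.continuous.comp
        (continuous_id.smul continuous_const)).continuousOn
    · exact fun x _ d ℓ => ((hline x d).chart_symm hX n).2 ℓ
    · simp only [zero_smul, chart_symm_zero]
    · intro z _
      rw [mem_centerSet_iff_chart hX, Homeomorph.apply_symm_apply]
      exact Submodule.smul_mem _ _ (mem_linKer.2 hh)
    · simp only [sub_zero]
      refine tendsto_inv_smul_chart_symm hX n (tendsto_const_nhds.congr' ?_)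
      filter_upwards [self_mem_nhdsWithin] with z hz
      exact (inv_smul_smul₀ hz h).symm

end Topology

end CenterProblem

theorem corollary2p3
    -- any locally convex topology on `X` with continuous coordinates, such as the product topology
    [TopologicalSpace CenterProblem.X] [IsTopologicalAddGroup CenterProblem.X]
    [ContinuousSMul ℂ CenterProblem.X] [LocallyConvexSpace ℝ CenterProblem.X]
    (hX : ∀ i : ℕ+, Continuous fun a : CenterProblem.X => a.coord i)
    (n : ℕ+) :
    (∃ f ∈ CenterProblem.iterPoly n (n - 1), ∀ a : CenterProblem.X,
      CenterProblem.c n a = CenterProblem.linInt n a + f a) ∧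
    (IsClosed (CenterProblem.centerSet n) ∧
      CenterProblem.IsComplexSubmanifold (CenterProblem.centerSet n) n ∧
      (0 : CenterProblem.X) ∈ CenterProblem.centerSet n) ∧
    CenterProblem.tangentVectors (CenterProblem.centerSet n) 0 =
      {a : CenterProblem.X | ∀ k ≤ n, CenterProblem.linInt k a = 0} :=
  ⟨⟨CenterProblem.higherPart n, CenterProblem.higherPart_mem_iterPoly n, CenterProblem.c_eq n⟩,
    ⟨CenterProblem.isClosed_centerSet hX n, CenterProblem.isComplexSubmanifold_centerSet hX n,
      CenterProblem.zero_mem_centerSet n⟩,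
    CenterProblem.tangentVectors_centerSet hX n⟩
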